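/- Let $p$ be a prime and $S$ a finite $p$-group. For $1\le i\le r$ let $G_i$ be a finite group with Sylow $p$-subgroup $S_i'$, and let $f_i\colon S_i'\to S$ be an injective homomorphism. A fusion system on a finite $p$-group $S$ is a category whose objects are the subgroups of $S$ and whose morphisms $P\to Q$ are (some of the) injective group homomorphisms, with composition of maps, such that: for $s\in S$ and $P,Q\le S$ with $s^{-1}Ps\le Q$, the map $P\to Q$, $u\mapsto s^{-1}us$, is a morphism; and if $\phi\colon P\to Q$ is a morphism with image $R$, then $\phi\colon P\to R$ and $\phi^{-1}\colon R\to P$ are morphisms. The fusion system generated by a collection of injective homomorphisms between subgroups of $S$ is the smallest fusion system on $S$ containing it. For a $p$-subgroup $S$ of a group $G$, $\mathcal F_S(G)$ is the fusion system on $S$ whose morphisms $P\to Q$ are the homomorphisms of the form $u\mapsto g^{-1}ug$ with $g\in G$. For an injective homomorphism $f\colon S'\to S$ and a fusion system $\mathcal F'$ on $S'$, $f_*(\mathcal F')$ is the collection of all maps $f\circ\phi'\circ f^{-1}\colon f(P')\to f(Q')$ with $\phi'\colon P'\to Q'$ in $\mathcal F'$. Let $\mathcal F$ be the fusion system on $S$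 generated by $(f_i)_*(\mathcal F_{S_i'}(G_i))$ for $1\le i\le r$, and let $G$ be the quotient of the free product $S*G_1*\cdots*G_r$ by the relations $s=f_i(s)$ for all $i$ and all $s\in S_i'$. Then the natural maps $S\to G$ and $G_i\to G$ are injective, so that $S$ and the $G_i$ may be regarded as subgroups of $G$; every $p$-subgroup of $G$ (that is, every subgroup all of whose elements have $p$-power order) is conjugate to a subgroup of $S$; and $\mathcal F_S(G)=\mathcal F$. Moreover, every finite subgroup of $G$ is conjugate to a subgroup of $S$ or to a subgroup of one of the $G_i$, and $G$ has a free normal subgroup of index dividing $N!$, where $N$ is the least common multiple of $|S|$ and the $|G_i|$. -/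

import Mathlib

/-- A fusion system on a group `S` (the case of interest is a finite `p`-group): a category whose
objects are the subgroups of `S` and whose morphisms from `P` to `Q` form a set of injective group
homomorphisms `P → Q`, composed as maps, such that conjugations by elements of `S` are morphisms,
and such that, for each morphism `φ : P → Q` with image `R`, both `φ : P → R` and its inverse
`R → P` are morphisms. (Identity maps are conjugations by `1`.) -/
@[ext]
structure FusionSystem (S : Type*) [Group S] where
  /-- the set of morphisms from `P` to `Q` -/
  Hom : ∀ P Q : Subgroup S, Set (P →* Q)
  injective : ∀ {P Q : Subgroup S} {φ : P →* Q}, φ ∈ Hom P Q → Function.Injective φ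
  comp_mem : ∀ {P Q R : Subgroup S} {φ : P →* Q} {ψ : Q →* R},
    φ ∈ Hom P Q → ψ ∈ Hom Q R → ψ.comp φ ∈ Hom P R
  conj_mem : ∀ {P Q : Subgroup S} (s : S) (φ : P →* Q),
    (∀ u : P, (φ u : S) = s⁻¹ * (u : S) * s) → φ ∈ Hom P Q
  corestrict_mem : ∀ {P Q R : Subgroup S} {φ : P →* Q}, φ ∈ Hom P Q →
    R = φ.range.map Q.subtype → ∀ ψ : P →* R, (∀ u : P, (ψ u : S) = (φ u : S)) → ψ ∈ Hom P R
  inverse_mem : ∀ {P Q R : Subgroup S} {φ : P →* Q}, φ ∈ Hom P Q →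
    R = φ.range.map Q.subtype →
    ∀ ψ : R →* P, (∀ v : R, (φ (ψ v) : S) = (v : S)) → ψ ∈ Hom R P

namespace FusionSystem

/-- For an injective homomorphism `j : S → G`, by which `S` is regarded as a subgroup of `G`, the
category `F_S(G)`: its morphisms are the homomorphisms `φ : P → Q` between subgroups of `S` that
are equal to conjugation `u ↦ g⁻¹ u g` by some element `g` of `G`. -/
def ofEmbedding {S G : Type*} [Group S] [Group G] (j : S →* G) (hj : Function.Injective j) :
    FusionSystem S where
  Hom P Q := {φ | ∃ g : G, ∀ u : P, j (φ u) = g⁻¹ * j u * g}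
  injective := by
    rintro P Q φ ⟨g, hg⟩ u v huv
    have h : g⁻¹ * j u * g = g⁻¹ * j v * g := by rw [← hg, ← hg, huv]
    exact Subtype.ext (hj (by simpa using h))
  comp_mem := by
    rintro P Q R φ ψ ⟨g, hg⟩ ⟨h, hh⟩
    refine ⟨g * h, fun u => ?_⟩
    rw [MonoidHom.comp_apply, hh, hg]
    group
  conj_mem := by
    intro P Q s φ h
    exact ⟨j s, fun u => by rw [h]; simp⟩
  corestrict_mem := by
    rintro P Q R φ ⟨g, hg⟩ - ψ h
    exact ⟨g, fun u => by rw [h, hg]⟩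
  inverse_mem := by
    rintro P Q R φ ⟨g, hg⟩ - ψ h
    refine ⟨g⁻¹, fun v => ?_⟩
    have := hg (ψ v)
    rw [h] at this
    rw [this]
    group

/-- The fusion system generated by a collection `Φ` of injective homomorphisms between subgroups
of `S`: the intersection of all fusion systems on `S` that contain `Φ`. -/
def generate {S : Type*} [Group S] (Φ : ∀ P Q : Subgroup S, Set (P →* Q)) :
    FusionSystem S where
  Hom P Q := {φ | Function.Injective φ ∧
    ∀ F : FusionSystem S, (∀ P' Q', Φ P' Q' ⊆ F.Hom P' Q') → φ ∈ F.Hom P Q}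
  injective h := h.1
  comp_mem h₁ h₂ := ⟨h₂.1.comp h₁.1, fun F hF => F.comp_mem (h₁.2 F hF) (h₂.2 F hF)⟩
  conj_mem := by
    intro P Q s φ h
    refine ⟨fun u v huv => ?_, fun F _ => F.conj_mem s φ h⟩
    have e : s⁻¹ * (u : S) * s = s⁻¹ * (v : S) * s := by rw [← h, ← h, huv]
    exact Subtype.ext (by simpa using e)
  corestrict_mem := by
    intro P Q R φ hφ hR ψ h
    refine ⟨fun u v huv => hφ.1 (Subtype.ext ?_),
      fun F hF => F.corestrict_mem (hφ.2 F hF) hR ψ h⟩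
    rw [← h, ← h, huv]
  inverse_mem := by
    intro P Q R φ hφ hR ψ h
    refine ⟨fun u v huv => Subtype.ext ?_, fun F hF => F.inverse_mem (hφ.2 F hF) hR ψ h⟩
    rw [← h, ← h, huv]

/-- `generate Φ` is the smallest fusion system containing `Φ`. -/
theorem generate_isLeast {S : Type*} [Group S] (Φ : ∀ P Q : Subgroup S, Set (P →* Q))
    (hΦ : ∀ P Q, ∀ φ ∈ Φ P Q, Function.Injective φ) :
    (∀ P Q, Φ P Q ⊆ (generate Φ).Hom P Q) ∧
      ∀ F : FusionSystem S, (∀ P Q, Φ P Q ⊆ F.Hom P Q) →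
        ∀ P Q, (generate Φ).Hom P Q ⊆ F.Hom P Q :=
  ⟨fun P Q φ hφ => ⟨hΦ P Q φ hφ, fun _ hF => hF P Q hφ⟩, fun F hF _ _ _ hφ => hφ.2 F hF⟩

/-- The image `f_*(F')` of a fusion system `F'` on `S'` under a homomorphism `f : S' → S` (which is
injective in the case of interest): the morphisms `f ∘ φ' ∘ f⁻¹ : f(P') → f(Q')`, for `φ' : P' → Q'`
in `F'`. -/
def image {S' S : Type*} [Group S'] [Group S] (f : S' →* S) (F' : FusionSystem S')
    (P Q : Subgroup S) : Set (P →* Q) :=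
  {φ | ∃ (P' Q' : Subgroup S') (φ' : P' →* Q'), φ' ∈ F'.Hom P' Q' ∧
    P'.map f = P ∧ Q'.map f = Q ∧
    ∀ (x : P') (y : P), (y : S) = f x → (φ y : S) = f (φ' x)}

end FusionSystem

section StarAmalgam

variable {S : Type*} [Group S] {r : ℕ} {G : Fin r → Type*} [∀ i, Group (G i)]
  {T : ∀ i, Subgroup (G i)}

/-- The quotient of the free product `S * G₁ * ⋯ * Gᵣ` by the relations `s = fᵢ(s)`, for all `i`
and all `s` in the subgroup `Tᵢ` of `Gᵢ`, where `fᵢ : Tᵢ → S`. -/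
abbrev StarAmalgam (f : ∀ i, T i →* S) : Type _ :=
  Monoid.Coprod S (Monoid.CoprodI G) ⧸ Subgroup.normalClosure
    {x : Monoid.Coprod S (Monoid.CoprodI G) | ∃ (i : Fin r) (s : T i),
      x = Monoid.Coprod.inr (Monoid.CoprodI.of (s : G i)) * (Monoid.Coprod.inl (f i s))⁻¹}

/-- The natural map from `S` to the amalgam. -/
def StarAmalgam.base (f : ∀ i, T i →* S) : S →* StarAmalgam f :=
  (QuotientGroup.mk' _).comp Monoid.Coprod.inl

/-- The natural map from `Gᵢ` to the amalgam. -/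
def StarAmalgam.of (f : ∀ i, T i →* S) (i : Fin r) : G i →* StarAmalgam f :=
  (QuotientGroup.mk' _).comp (Monoid.Coprod.inr.comp Monoid.CoprodI.of)

end StarAmalgam

/-!
Write `Γ` for the amalgam. All parts rest on two consequences of the universal property of `Γ`.

*A permutation representation.* `S` and the `Gᵢ` act freely on a set of `N` points, and two free
actions of `Tᵢ` on sets of the same finite size are isomorphic, so these actions can be matched
along the `Tᵢ` (`exists_permutation_representation`). The resulting action of `Γ` shows that `S` and
the `Gᵢ` embed, and its kernel `K`, whose index divides `N!`, meets them trivially.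

*Crossed homomorphisms.* If `Γ` acts on `X`, then `Tᵢ`-invariant functions `hᵢ` from `X` to a group
`L` determine a crossed homomorphism from `Γ` to the functions `X → L` which is trivial on `S` and
the coboundary of `hᵢ` on `Gᵢ` (`exists_crossed`). This is used twice.

* For `X = Γ ⧸ K`, where `S` and the `Gᵢ` act freely, it shows that the action groupoid of `Γ` on
  `X` is free: functors to a group are cocycles, and a cocycle can be prescribed arbitrarily on
  arrows from orbit representatives. Vertex groups of connected free groupoids are free, so `K` is
  free (`isFreeGroup_of_normal`).
* For `X` the cosets of `Tᵢ` and `hᵢ` the indicator function of the base point, it labels the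
  vertices of the graph of cosets of `S` and of the `Gᵢ`, in such a way that exactly one edge has
  ends with different labels. So every edge is a bridge, and this Bass–Serre graph is a tree
  (`tree_isTree`).

A finite subgroup of `Γ` fixes a vertex of the tree (`exists_conj_le_of_finite`). A `p`-subgroup is
finite because the free group `K` has no torsion, and by Sylow's theorem in the `Gᵢ` it is conjugate
into `S` (`exists_conj_le_base`). If `g` conjugates a subgroup `P` of `S` into `S`, then `P` fixes
the path from `S` to `g S` in the tree, and this path writes the conjugation as a composite of
conjugations in `S` and in the `Gᵢ` (`mem_hom_of_conj`).
-/

/-! ### Finite groups acting on trees -/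

namespace SimpleGraph

variable {V : Type*} {Γ : SimpleGraph V}

/-- In a tree, all neighbours of `v` but one are farther than `v` from a given vertex `x`. -/
theorem IsTree.eq_of_adj_of_dist (hΓ : Γ.IsTree) {x v u w : V} (hu : Γ.Adj u v) (hw : Γ.Adj w v)
    (hdu : Γ.dist x v = Γ.dist x u + 1) (hdw : Γ.dist x v = Γ.dist x w + 1) : u = w := by
  obtain ⟨p, hp, hp'⟩ := (hΓ.connected x u).exists_path_of_dist
  obtain ⟨q, hq, hq'⟩ := (hΓ.connected x w).exists_path_of_dist
  have h₁ : (p.concat hu).IsPath := Walk.isPath_of_length_eq_dist _ (by simp [hp', hdu])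
  have h₂ : (q.concat hw).IsPath := Walk.isPath_of_length_eq_dist _ (by simp [hq', hdw])
  have h₃ := (hΓ.existsUnique_path x v).unique h₁ h₂
  simpa using congrArg Walk.penultimate h₃

/-- The sum of the squares of the distances to given points is strictly convex along the paths of a
tree. -/
theorem IsTree.sum_sq_dist_convex (hΓ : Γ.IsTree) {ι : Type*} [Fintype ι] [Nonempty ι] (x : ι → V)
    {u v w : V} (hu : Γ.Adj u v) (hw : Γ.Adj w v) (huw : u ≠ w) :
    2 * ∑ i, Γ.dist (x i) v ^ 2 < ∑ i, Γ.dist (x i) u ^ 2 + ∑ i, Γ.dist (x i) w ^ 2 := by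
  rw [Finset.mul_sum, ← Finset.sum_add_distrib]
  refine Finset.sum_lt_sum_of_nonempty Finset.univ_nonempty fun i _ => ?_
  have h₁ := hΓ.dist_eq_dist_add_one_of_adj (x i) hu
  have h₂ := hΓ.dist_eq_dist_add_one_of_adj (x i) hw
  rcases h₁ with h₁ | h₁ <;> rcases h₂ with h₂ | h₂
  · rw [h₁, h₂]; nlinarith
  · rw [h₁, h₂]; nlinarith
  · rw [h₂, h₁]; nlinarith
  · exact absurd (hΓ.eq_of_adj_of_dist hu hw h₁ h₂) huw

/-- A strictly convex function which does not decrease in the first step of a path increases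
afterwards. -/
theorem lt_of_strictly_convex_of_isPath {φ : V → ℕ}
    (hφ : ∀ u v w, Γ.Adj u v → Γ.Adj w v → u ≠ w → 2 * φ v < φ u + φ w) {v u w : V}
    (h : Γ.Adj v u) (p : Γ.Walk u w) (hp : (p.cons h).IsPath) (hle : φ v ≤ φ u) :
    u = w ∨ φ u < φ w := by
  induction p generalizing v with
  | nil => exact Or.inl rfl
  | @cons u u' w h' p ih =>
    right
    have hne : v ≠ u' := by
      rintro rfl
      simp at hp
    have h₁ := hφ v u u' h h'.symm hne
    rcases ih h' hp.of_cons (by omega) with rfl | h₂ <;> omega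

theorem dist_smul {H : Type*} [Group H] [MulAction H V]
    (hadj : ∀ (h : H) u v, Γ.Adj u v → Γ.Adj (h • u) (h • v)) (h : H) (u v : V) :
    Γ.dist (h • u) (h • v) = Γ.dist u v := by
  have hle : ∀ (h : H) u v, Γ.dist (h • u) (h • v) ≤ Γ.dist u v := fun h u v => by
    by_cases huv : Γ.Reachable u v
    · obtain ⟨p, hp⟩ := huv.exists_walk_length_eq_dist
      let φ : Γ →g Γ := ⟨fun v => h • v, fun {a b} => hadj h a b⟩
      rw [← hp, ← Walk.length_map φ]
      exact dist_le _
    · rw [dist_eq_zero_of_not_reachable (u := h • u)]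
      · exact Nat.zero_le _
      · intro hcon
        let φ : Γ →g Γ := ⟨fun v => h⁻¹ • v, fun {a b} => hadj h⁻¹ a b⟩
        exact huv (by simpa [φ] using hcon.map φ)
  refine (hle h u v).antisymm ?_
  simpa using hle h⁻¹ (h • u) (h • v)

theorem Connected.exists_adj_dist_eq_add_one (hΓ : Γ.Connected) {x v : V} (hne : v ≠ x) :
    ∃ m, Γ.Adj m v ∧ Γ.dist x v = Γ.dist x m + 1 := by
  obtain ⟨p, hp⟩ := hΓ.exists_walk_length_eq_dist v x
  cases p with
  | nil => exact absurd rfl hne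
  | @cons _ m _ h p =>
    refine ⟨m, h.symm, ?_⟩
    have h₁ := dist_le p
    have h₂ : Γ.dist v x ≤ Γ.dist v m + Γ.dist m x := hΓ.dist_triangle
    rw [SimpleGraph.dist_eq_one_iff_adj.2 h] at h₂
    rw [Walk.length_cons] at hp
    rw [dist_comm, Γ.dist_comm (u := x)]
    omega

/-- An automorphism fixing two vertices of a tree fixes the first step of the path between them. -/
theorem IsTree.smul_eq_of_adj_of_dist (hΓ : Γ.IsTree) {H : Type*} [Group H] [MulAction H V]
    (hadj : ∀ (h : H) u v, Γ.Adj u v → Γ.Adj (h • u) (h • v)) {h : H} {x v m : V}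
    (hx : h • x = x) (hv : h • v = v) (hm : Γ.Adj m v) (hdist : Γ.dist x v = Γ.dist x m + 1) :
    h • m = m := by
  refine hΓ.eq_of_adj_of_dist (x := x) (v := v) ?_ hm ?_ hdist
  · simpa [hv] using hadj h _ _ hm
  · rw [hdist, ← dist_smul hadj h x m, hx]

/-- A finite group acting on a tree has a fixed vertex, provided that no edge is inverted: a vertex
which minimizes the sum of the squares of the distances to an orbit is fixed, because that function
is strictly convex along the path to any of its images. -/
theorem IsTree.exists_fixed_vertex (hΓ : Γ.IsTree) {H : Type*} [Group H] [Finite H] [MulAction H V]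
    (hadj : ∀ (h : H) u v, Γ.Adj u v → Γ.Adj (h • u) (h • v))
    (hinv : ∀ (h : H) v, ¬ Γ.Adj v (h • v)) : ∃ v : V, ∀ h : H, h • v = v := by
  have := Fintype.ofFinite H
  obtain ⟨x⟩ := hΓ.connected.nonempty
  let φ : V → ℕ := fun v => ∑ h : H, Γ.dist (h • x) v ^ 2
  have hφ : ∀ (h : H) v, φ (h • v) = φ v := fun h v => by
    refine (Equiv.sum_comp (Equiv.mulLeft h) fun k : H => Γ.dist (k • x) (h • v) ^ 2).symm.trans ?_
    simp [φ, mul_smul, dist_smul hadj]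
  obtain ⟨v, -, hv⟩ := (measure φ).wf.has_min Set.univ ⟨x, trivial⟩
  refine ⟨v, fun h => ?_⟩
  by_contra hne
  obtain ⟨w, hw⟩ : ∃ w, h • v = w := ⟨_, rfl⟩
  obtain ⟨p, hp⟩ := (hΓ.existsUnique_path v w).exists
  cases p with
  | nil => exact hne hw
  | cons h' p =>
    rcases lt_of_strictly_convex_of_isPath
      (fun _ _ _ => hΓ.sum_sq_dist_convex fun h : H => h • x) h' p hp
      (not_lt.1 (hv _ trivial)) with rfl | h₂
    · exact hinv h v (hw ▸ h')
    · exact hv _ trivial (h₂.trans_eq (hw ▸ hφ h v))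

end SimpleGraph

namespace StarAmalgam

/-! ### The universal property and crossed homomorphisms -/

section Universal

variable {S : Type*} [Group S] {r : ℕ} {G : Fin r → Type*} [∀ i, Group (G i)]
  {T : ∀ i, Subgroup (G i)} (f : ∀ i, T i →* S)

theorem of_eq_base (i : Fin r) (t : T i) : of f i t = base f (f i t) := by
  rw [← mul_inv_eq_one, ← map_inv]
  refine (QuotientGroup.eq_one_iff _).2 (Subgroup.subset_normalClosure ⟨i, t, ?_⟩)
  simp

/-- Homomorphisms from `S` and the `Gᵢ` that are compatible along the `fᵢ` extend to the
amalgam. -/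
theorem exists_lift {L : Type*} [Group L] (a : S →* L) (b : ∀ i, G i →* L)
    (h : ∀ i (t : T i), b i t = a (f i t)) :
    ∃ φ : StarAmalgam f →* L, (∀ s, φ (base f s) = a s) ∧ ∀ i g, φ (of f i g) = b i g := by
  refine ⟨QuotientGroup.lift _ (Monoid.Coprod.lift a (Monoid.CoprodI.lift b)) ?_,
    fun s => ?_, fun i g => ?_⟩
  · intro x hx
    have hle : Subgroup.normalClosure _ ≤
        (Monoid.Coprod.lift a (Monoid.CoprodI.lift b)).ker :=
      Subgroup.normalClosure_le_normal (s := {x : Monoid.Coprod S (Monoid.CoprodI G) |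
        ∃ (i : Fin r) (s : T i), x = Monoid.Coprod.inr (Monoid.CoprodI.of (s : G i)) *
          (Monoid.Coprod.inl (f i s))⁻¹}) (by
        rintro _ ⟨i, t, rfl⟩
        simp [h])
    exact hle hx
  · change Monoid.Coprod.lift a (Monoid.CoprodI.lift b) (Monoid.Coprod.inl s) = _
    simp
  · change Monoid.Coprod.lift a (Monoid.CoprodI.lift b)
      (Monoid.Coprod.inr (Monoid.CoprodI.of g)) = _
    simp

theorem induction_on {motive : StarAmalgam f → Prop} (x : StarAmalgam f)
    (hbase : ∀ s, motive (base f s)) (hof : ∀ i g, motive (of f i g))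
    (hmul : ∀ x y, motive x → motive y → motive (x * y)) : motive x := by
  obtain ⟨y, rfl⟩ := QuotientGroup.mk_surjective x
  induction y using Monoid.Coprod.induction_on with
  | inl s => exact hbase s
  | inr z =>
    induction z using Monoid.CoprodI.induction_on with
    | one => simpa using hbase 1
    | of i g => exact hof i g
    | mul u v hu hv => simpa using hmul _ _ hu hv
  | mul u v hu hv => simpa using hmul _ _ hu hv

open SemidirectProduct in
/-- A crossed homomorphism on the amalgam, with values in the functions from a set `X` acted on by
the amalgam to a group `L`: it is trivial on `S`, and on `Gᵢ` it is the coboundary of a prescribed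
`Tᵢ`-invariant function `hᵢ`. It is the first component of a homomorphism to the semidirect product
of `X → L` by the amalgam, which is conjugate on each `Gᵢ` to the obvious one. -/
theorem exists_crossed {X L : Type*} [MulAction (StarAmalgam f) X] [Group L] (h : Fin r → X → L)
    (hh : ∀ i (t : T i) x, h i (of f i t • x) = h i x) :
    ∃ c : StarAmalgam f → X → L,
      (∀ g g' x, c (g * g') x = c g x * c g' (g⁻¹ • x)) ∧
      (∀ s x, c (base f s) x = 1) ∧
      ∀ i k x, c (of f i k) x = h i x * (h i ((of f i k)⁻¹ • x))⁻¹ := by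
  obtain ⟨φ, hS, hG⟩ := exists_lift f
    (L := (X → L) ⋊[mulAutArrow] StarAmalgam f)
    (inr.comp (base f))
    (fun i => (MulAut.conj (inl (h i))).toMonoidHom.comp (inr.comp (of f i))) (by
      intro i t
      simp only [MonoidHom.comp_apply, MulEquiv.coe_toMonoidHom, MulAut.conj_apply, ← of_eq_base]
      rw [mul_inv_eq_iff_eq_mul]
      ext x
      · simp only [mul_left, left_inl, left_inr, right_inl, right_inr, Pi.mul_apply, Pi.one_apply]
        have ht : (mulAutArrow (of f i t)) (h i) x = h i ((of f i t)⁻¹ • x) := rfl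
        rw [ht, ← map_inv, ← Subgroup.coe_inv, hh]
        simp
      · simp)
  have hright : ∀ g, (φ g).right = g := by
    intro g
    induction g using induction_on with
    | hbase s => simp [hS]
    | hof i k => simp [hG]
    | hmul x y hx hy => simp [hx, hy]
  refine ⟨fun g => (φ g).left, fun g g' x => ?_, fun s x => ?_, fun i k x => ?_⟩
  · simp only [map_mul, mul_left, hright, Pi.mul_apply]
    rfl
  · simp [hS]
  · simp only [hG, MonoidHom.comp_apply, MulEquiv.coe_toMonoidHom, MulAut.conj_apply, ← map_inv inl,
      mul_left, left_inl, left_inr, right_inl, Pi.mul_apply, map_one, mul_one]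
    rfl

end Universal

/-! ### A permutation representation -/

/-- A free action is isomorphic to left multiplication on copies of the group. -/
theorem bijective_smul_out {H Z : Type*} [Group H] [MulAction H Z]
    (hZ : ∀ (h : H) (z : Z), h • z = z → h = 1) :
    Function.Bijective
      fun p : H × Quotient (MulAction.orbitRel H Z) => p.1 • (Quotient.out p.2 : Z) := by
  constructor
  · rintro ⟨a, ω⟩ ⟨b, ω'⟩ hab
    simp only at hab
    have hω : ω = ω' := by
      rw [← Quotient.out_eq ω, ← Quotient.out_eq ω']
      refine Quotient.sound ⟨a⁻¹ * b, ?_⟩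
      simp only [mul_smul, ← hab, inv_smul_smul]
    subst hω
    have := hZ (b⁻¹ * a) ω.out (by rw [mul_smul, hab, inv_smul_smul])
    rw [inv_mul_eq_one.1 this]
  · intro z
    obtain ⟨h, hh⟩ := Quotient.exact (Quotient.out_eq (Quotient.mk (MulAction.orbitRel H Z) z))
    exact ⟨⟨h⁻¹, Quotient.mk _ z⟩, by simp only [← hh, inv_smul_smul]⟩

/-- Two free actions of a finite group on finite sets of the same size are isomorphic. -/
theorem exists_equivariant_equiv {H X Y : Type*} [Group H] [Finite H] [MulAction H X]
    [MulAction H Y] [Finite X] [Finite Y] (hX : ∀ (h : H) (x : X), h • x = x → h = 1)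
    (hY : ∀ (h : H) (y : Y), h • y = y → h = 1) (hcard : Nat.card X = Nat.card Y) :
    ∃ e : X ≃ Y, ∀ (h : H) (x : X), e (h • x) = h • e x := by
  let eX := Equiv.ofBijective _ (bijective_smul_out hX)
  let eY := Equiv.ofBijective _ (bijective_smul_out hY)
  have hΩ : Nat.card (Quotient (MulAction.orbitRel H X)) =
      Nat.card (Quotient (MulAction.orbitRel H Y)) := by
    rw [← Nat.card_congr eX, ← Nat.card_congr eY, Nat.card_prod, Nat.card_prod] at hcard
    exact Nat.eq_of_mul_eq_mul_left Nat.card_pos hcard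
  obtain ⟨eΩ⟩ := (Finite.card_eq).1 hΩ
  refine ⟨eX.symm.trans (((Equiv.refl H).prodCongr eΩ).trans eY), fun h x => ?_⟩
  obtain ⟨⟨a, ω⟩, rfl⟩ := eX.surjective x
  have : h • eX (a, ω) = eX (h * a, ω) := (mul_smul _ _ _).symm
  rw [this]
  simp [eY, mul_smul]

section Permutation

variable {S : Type*} [Group S] {r : ℕ} {G : Fin r → Type*} [∀ i, Group (G i)]
  {T : ∀ i, Subgroup (G i)} (f : ∀ i, T i →* S)

/-- If `S` and the `Gᵢ` are finite of orders dividing `N`, all of them act freely on `N` points, and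
these actions can be matched along the `Tᵢ`: the amalgam acts. -/
theorem exists_permutation_representation [Finite S] [∀ i, Finite (G i)]
    (hf : ∀ i, Function.Injective (f i)) {N : ℕ} (hS : Nat.card S ∣ N)
    (hG : ∀ i, Nat.card (G i) ∣ N) :
    ∃ φ : StarAmalgam f →* Equiv.Perm (S × Fin (N / Nat.card S)),
      (∀ s x, φ (base f s) x = x → s = 1) ∧ ∀ i k x, φ (of f i k) x = x → k = 1 := by
  let X := S × Fin (N / Nat.card S)
  let Y := fun i => G i × Fin (N / Nat.card (G i))
  -- left multiplication on the first factor
  let a : S →* Equiv.Perm X :=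
    { toFun := fun s => (Equiv.mulLeft s).prodCongr (Equiv.refl _)
      map_one' := by ext x <;> simp
      map_mul' := fun s s' => by ext x <;> simp [mul_assoc] }
  let b : ∀ i, G i →* Equiv.Perm (Y i) := fun i =>
    { toFun := fun s => (Equiv.mulLeft s).prodCongr (Equiv.refl _)
      map_one' := by ext x <;> simp
      map_mul' := fun s s' => by ext x <;> simp [mul_assoc] }
  have ha : ∀ s x, a s x = x → s = 1 := fun s x h => by
    have h₁ : s * x.1 = x.1 := congrArg Prod.fst h
    simpa using h₁
  have hb : ∀ i k x, b i k x = x → k = 1 := fun i k x h => by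
    have h₁ : k * x.1 = x.1 := congrArg Prod.fst h
    simpa using h₁
  have hcard : ∀ i, Nat.card X = Nat.card (Y i) := fun i => by
    simp only [X, Y, Nat.card_prod, Nat.card_fin, Nat.mul_div_cancel' hS,
      Nat.mul_div_cancel' (hG i)]
  have he : ∀ i, ∃ e : X ≃ Y i, ∀ (t : T i) x, e (a (f i t) x) = b i t (e x) := by
    intro i
    let _ : MulAction (T i) X := MulAction.compHom X (a.comp (f i))
    let _ : MulAction (T i) (Y i) := MulAction.compHom (Y i) ((b i).comp (T i).subtype)
    refine exists_equivariant_equiv (H := T i) (X := X) (Y := Y i) (fun t x h => ?_)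
      (fun t y h => ?_) (hcard i)
    · exact hf i ((ha _ _ h).trans (map_one _).symm)
    · exact Subtype.ext (hb i _ _ h)
  choose e he using he
  obtain ⟨φ, hφS, hφG⟩ := exists_lift f a
    (fun i => ((e i).symm.permCongrHom.toMonoidHom).comp (b i)) (by
      intro i t
      ext1 x
      simp [← he])
  refine ⟨φ, fun s x h => ha s x (by rwa [hφS] at h), fun i k x h => hb i k (e i x) ?_⟩
  rw [hφG] at h
  simpa [Equiv.symm_apply_eq] using h

end Permutation

/-! ### Free normal subgroups -/

section FreeKernel

/-- Representatives of the orbits of a group acting on a set through a homomorphism, together with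
elements moving the representatives to the given points. -/
theorem exists_orbit_representatives {H Γ X : Type*} [Group H] [Group Γ] [MulAction Γ X]
    (j : H →* Γ) :
    ∃ (ρ : X → X) (a : X → H), (∀ x, j (a x) • ρ x = x) ∧ ∀ h x, ρ (j h • x) = ρ x := by
  let _ : MulAction H X := MulAction.compHom X j
  let ρ : X → X := fun x => (Quotient.mk (MulAction.orbitRel H X) x).out
  have h₁ : ∀ x, ∃ h : H, j h • ρ x = x := fun x => by
    obtain ⟨h, hh⟩ := Quotient.exact (Quotient.out_eq (Quotient.mk (MulAction.orbitRel H X) x))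
    refine ⟨h⁻¹, ?_⟩
    rw [map_inv, inv_smul_eq_iff]
    exact hh.symm
  choose a ha using h₁
  refine ⟨ρ, a, ha, fun h x => ?_⟩
  have : Quotient.mk (MulAction.orbitRel H X) (j h • x) = Quotient.mk _ x := Quotient.sound ⟨h, rfl⟩
  simp only [ρ, this]

/-- For a free action of `H`, a cocycle is determined on `H` by its values on the elements which
carry orbit representatives to arbitrary points. -/
theorem cocycle_eq_of_representatives {H Γ X L : Type*} [Group H] [Group Γ] [MulAction Γ X]
    [Group L] {j : H →* Γ} (hfree : ∀ (h : H) (x : X), j h • x = x → h = 1)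
    {ρ : X → X} {a : X → H} (ha : ∀ x, j (a x) • ρ x = x) (hρ : ∀ h x, ρ (j h • x) = ρ x)
    {c c' : Γ → X → L} (hc : ∀ g g' x, c (g * g') x = c g x * c g' (g⁻¹ • x))
    (hc' : ∀ g g' x, c' (g * g') x = c' g x * c' g' (g⁻¹ • x))
    (h : ∀ x, c (j (a x)) x = c' (j (a x)) x) (k : H) (x : X) : c (j k) x = c' (j k) x := by
  have hρ' : ρ ((j k)⁻¹ • x) = ρ x := by rw [← map_inv, hρ]
  have hax : a x = k * a ((j k)⁻¹ • x) := by
    rw [← inv_mul_eq_one]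
    refine hfree _ (ρ ((j k)⁻¹ • x)) ?_
    simp only [map_mul, map_inv, mul_smul, ha, smul_inv_smul]
    rw [inv_smul_eq_iff, hρ', ha]
  have h₁ := h x
  rw [hax, map_mul, hc, hc', h] at h₁
  exact mul_right_cancel h₁

variable {S : Type*} [Group S] {r : ℕ} {G : Fin r → Type*} [∀ i, Group (G i)]
  {T : ∀ i, Subgroup (G i)} (f : ∀ i, T i →* S)

/-- If the amalgam acts on `X` in such a way that `S` and the `Gᵢ` act freely, then its action
groupoid is free: there are arrows `ρₑ x ⟶ x`, given by `aₑ x` and indexed by `e` and by `x ∈ Vₑ`,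
on which cocycles can be prescribed arbitrarily and by which they are determined. The index `none`
belongs to `S`, and its arrows join the chosen point of an `S`-orbit to the other points; the index
`some i` belongs to `Gᵢ`, and its arrows join one chosen point of a `Gᵢ`-orbit to chosen points of
the other `Tᵢ`-orbits in it. -/
theorem exists_free_arrows {X : Type*} [MulAction (StarAmalgam f) X]
    (hS : ∀ s (x : X), base f s • x = x → s = 1)
    (hG : ∀ i k (x : X), of f i k • x = x → k = 1) :
    ∃ (ρ : Option (Fin r) → X → X) (a : Option (Fin r) → X → StarAmalgam f)
      (V : Option (Fin r) → Set X), (∀ e x, a e x • ρ e x = x) ∧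
      ∀ (L : Type*) [Group L],
        (∀ ℓ : Option (Fin r) → X → L, ∃ c : StarAmalgam f → X → L,
          (∀ g g' x, c (g * g') x = c g x * c g' (g⁻¹ • x)) ∧
          ∀ e, ∀ x ∈ V e, c (a e x) x = ℓ e x) ∧
        ∀ c c' : StarAmalgam f → X → L,
          (∀ g g' x, c (g * g') x = c g x * c g' (g⁻¹ • x)) →
          (∀ g g' x, c' (g * g') x = c' g x * c' g' (g⁻¹ • x)) →
          (∀ e, ∀ x ∈ V e, c (a e x) x = c' (a e x) x) → c = c' := by
  classical
  obtain ⟨s₀, σ, hσ, hs₀⟩ := exists_orbit_representatives (X := X) (base f)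
  choose p α hα hp using fun i => exists_orbit_representatives (X := X) (of f i)
  choose t τ hτ ht using fun i =>
    exists_orbit_representatives (X := X) ((of f i).comp (T i).subtype)
  simp only [MonoidHom.comp_apply, Subgroup.coe_subtype] at hτ ht
  -- the base point of a `Gᵢ`-orbit is chosen among the representatives of its `Tᵢ`-orbits
  let q : Fin r → X → X := fun i x => t i (p i x)
  let γ : ∀ i, X → G i := fun i x => α i x * τ i (p i x)
  have hγ : ∀ i x, of f i (γ i x) • q i x = x := fun i x => by
    simp only [γ, q, map_mul, mul_smul, hτ, hα]
  have hq : ∀ i k x, q i (of f i k • x) = q i x := fun i k x => by simp only [q, hp]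
  have htt : ∀ i x, t i (t i x) = t i x := fun i x => by
    conv_rhs => rw [← hτ i x, ht]
  have hqq : ∀ i x, q i (q i x) = q i x := fun i x => by
    conv_rhs => rw [← hγ i x, hq]
  have hss : ∀ x, s₀ (s₀ x) = s₀ x := fun x => by
    conv_rhs => rw [← hσ x, hs₀]
  have htq : ∀ i x, t i (q i x) = q i x := fun i x => htt i _
  refine ⟨fun e => e.elim s₀ q, fun e => e.elim (fun x => base f (σ x)) fun i x => of f i (γ i x),
    fun e => e.elim {x | s₀ x ≠ x} fun i => {x | t i x = x ∧ q i x ≠ x}, ?_, fun L _ => ⟨?_, ?_⟩⟩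
  · rintro (_ | i) x
    · exact hσ x
    · exact hγ i x
  · intro ℓ
    let h : X → L := fun x => if s₀ x = x then 1 else ℓ none x
    let k : Fin r → X → L := fun i x => if q i x = x then 1 else ℓ (some i) x
    obtain ⟨c, hc, hcS, hcG⟩ := exists_crossed f (X := X)
      (fun i x => (h (t i x))⁻¹ * k i (t i x)) (fun i u x => by simp only [ht])
    refine ⟨fun g x => h x * c g x * (h (g⁻¹ • x))⁻¹, fun g g' x => ?_, ?_⟩
    · simp only [hc, mul_inv_rev, mul_smul]
      group
    · rintro (_ | i) x hx
      · have hx' : ¬ s₀ x = x := hx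
        have h₁ : (base f (σ x))⁻¹ • x = s₀ x := by rw [inv_smul_eq_iff, hσ]
        simp only [Option.elim, h₁, hcS]
        simp [h, hss, hx']
      · obtain ⟨hx₁, hx₂⟩ : t i x = x ∧ q i x ≠ x := hx
        have h₁ : (of f i (γ i x))⁻¹ • x = q i x := by rw [inv_smul_eq_iff, hγ]
        simp only [Option.elim, hcG, h₁, hx₁, htq]
        simp only [k, hqq, hx₂, if_true, if_false]
        group
  · intro c c' hc hc' hcc
    have hone : ∀ d : StarAmalgam f → X → L,
        (∀ g g' x, d (g * g') x = d g x * d g' (g⁻¹ • x)) → ∀ x, d 1 x = 1 := fun d hd x => by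
      have := hd 1 1 x
      rwa [inv_one, one_smul, mul_one, left_eq_mul] at this
    have hSc : ∀ s x, c (base f s) x = c' (base f s) x := by
      refine cocycle_eq_of_representatives hS hσ hs₀ hc hc' fun x => ?_
      by_cases hx : s₀ x = x
      · have h₁ := hσ x
        rw [hx] at h₁
        rw [hS _ _ h₁, map_one, hone c hc, hone c' hc']
      · exact hcc none x hx
    have hGc : ∀ i k x, c (of f i k) x = c' (of f i k) x := fun i => by
      refine cocycle_eq_of_representatives (hG i) (hγ i) (hq i) hc hc' fun x => ?_
      have hrep : ∀ x, t i x = x → c (of f i (γ i x)) x = c' (of f i (γ i x)) x := fun x hx => by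
        by_cases hx' : q i x = x
        · have h₁ := hγ i x
          rw [hx'] at h₁
          rw [hG i _ _ h₁, map_one, hone c hc, hone c' hc']
        · exact hcc (some i) x ⟨hx, hx'⟩
      have hqt : q i (t i x) = q i x := by
        conv_rhs => rw [← hτ i x, hq]
      have h₁ : (of f i (τ i x))⁻¹ • x = t i x := by rw [inv_smul_eq_iff, hτ]
      have h₂ : γ i x = τ i x * γ i (t i x) := by
        rw [← inv_mul_eq_one]
        refine hG i _ (q i x) ?_
        simp only [map_mul, map_inv, mul_smul]
        rw [inv_smul_eq_iff, hγ, ← hqt, hγ, hτ]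
      rw [h₂, map_mul, hc, hc', h₁, hrep _ (htt i x), of_eq_base, hSc]
    funext g
    induction g using induction_on with
    | hbase s => exact funext (hSc s)
    | hof i k => exact funext (hGc i k)
    | hmul g g' h₁ h₂ => funext x; rw [hc, hc', h₁, h₂]

open CategoryTheory ActionCategory in
/-- The arrows of `exists_free_arrows` freely generate the action groupoid, since functors from it
to a group are the same as cocycles. -/
theorem nonempty_isFreeGroupoid {X : Type*} [MulAction (StarAmalgam f) X]
    (hS : ∀ s (x : X), base f s • x = x → s = 1)
    (hG : ∀ i k (x : X), of f i k • x = x → k = 1) :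
    Nonempty (IsFreeGroupoid (ActionCategory (StarAmalgam f) X)) := by
  classical
  obtain ⟨ρ, a, V, ha, hfree⟩ := exists_free_arrows f hS hG
  refine ⟨{
    quiverGenerators := ⟨fun x y => { e : ULift (Option (Fin r)) //
      ρ e.down (ActionCategory.back y) = ActionCategory.back x ∧
        ActionCategory.back y ∈ V e.down }⟩
    of := fun {x y} e => ⟨a e.1.down (ActionCategory.back y), by
      have h := ha e.1.down (ActionCategory.back y)
      rw [e.2.1] at h
      exact h⟩
    unique_lift := ?_ }⟩
  intro L _ lab
  obtain ⟨hex, huniq⟩ := hfree L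
  obtain ⟨c, hc, hcℓ⟩ := hex fun e x =>
    if h : x ∈ V e then @lab ⟨(), ρ e x⟩ ⟨(), x⟩ ⟨⟨e⟩, rfl, h⟩ else 1
  have hone : ∀ x, c 1 x = 1 := fun x => by
    have := hc 1 1 x
    rwa [inv_one, one_smul, mul_one, left_eq_mul] at this
  let φ : StarAmalgam f →* (X → L) ⋊[mulAutArrow] StarAmalgam f :=
    { toFun := fun g => ⟨c g, g⟩
      map_one' := by ext x <;> simp [hone]
      map_mul' := fun g g' => by
        ext x
        · exact hc g g' x
        · rfl }
  refine ⟨uncurry φ fun _ => rfl, ?_, ?_⟩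
  · rintro ⟨⟨⟩, x : X⟩ ⟨⟨⟩, y : X⟩ ⟨⟨e⟩, h : ρ e y = x, hy : y ∈ V e⟩
    subst h
    refine (hcℓ e y hy).trans ?_
    rw [dif_pos hy]
  · intro F hF
    let d : StarAmalgam f → X → L := fun g x => F.map (homOfPair x g)
    have hd : ∀ (g : StarAmalgam f) (x y : X) (h : g • x = y),
        @CategoryTheory.Functor.map _ _ _ _ F ⟨(), x⟩ ⟨(), y⟩ ⟨g, h⟩ = d g y := by
      intro g x y h
      cases inv_smul_eq_iff.mpr h.symm
      rfl
    have hdc : d = c := by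
      refine huniq _ _ (fun g g' x => ?_) hc fun e x hx => ?_
      · refine (hd (g * g') (g'⁻¹ • g⁻¹ • x) x (by simp [mul_smul])).symm.trans ?_
        exact F.map_comp (homOfPair (g⁻¹ • x) g') (homOfPair x g)
      · rw [hcℓ e x hx, dif_pos hx]
        exact (hd _ _ _ (ha e x)).symm.trans (hF ⟨(), ρ e x⟩ ⟨(), x⟩ ⟨⟨e⟩, rfl, hx⟩)
    refine Functor.hext (fun _ => Unit.ext _ _) ?_
    rintro ⟨⟨⟩, x : X⟩ ⟨⟨⟩, y : X⟩ g
    exact heq_of_eq ((hd g.1 x y g.2).trans (congrFun (congrFun hdc g.1) y))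

open CategoryTheory ActionCategory in
/-- A normal subgroup that meets `S` and the `Gᵢ` trivially is free. -/
theorem isFreeGroup_of_normal (K : Subgroup (StarAmalgam f)) [K.Normal]
    (hS : ∀ s, base f s ∈ K → s = 1) (hG : ∀ i k, of f i k ∈ K → k = 1) : IsFreeGroup K := by
  have key : ∀ (g : StarAmalgam f) (x : StarAmalgam f ⧸ K), g • x = x → g ∈ K := by
    intro g x
    induction x using QuotientGroup.induction_on with
    | H x =>
      intro h
      have h₁ := QuotientGroup.eq.1 h.symm
      have h₂ := (inferInstance : K.Normal).conj_mem _ h₁ x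
      simpa [mul_assoc] using h₂
  obtain ⟨_⟩ := nonempty_isFreeGroupoid f (X := StarAmalgam f ⧸ K)
    (fun s x h => hS s (key _ x h)) (fun i k x h => hG i k (key _ x h))
  let r₀ := objEquiv (StarAmalgam f) (StarAmalgam f ⧸ K) ↑(1 : StarAmalgam f)
  -- the category structures of the action category and of its groupoid agree only after unfolding
  have hconn : @IsConnected (ActionCategory (StarAmalgam f) (StarAmalgam f ⧸ K))
      Groupoid.toCategory := by
    exact (inferInstance : IsConnected (ActionCategory (StarAmalgam f) (StarAmalgam f ⧸ K)))
  have hfree := @IsFreeGroupoid.endIsFreeOfConnectedFree _ _ hconn _ r₀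
  exact @IsFreeGroup.ofMulEquiv (@End _ Groupoid.toCategory.toCategoryStruct r₀) (End.group r₀)
    hfree K _
    { toEquiv := (endMulEquivSubgroup K).toEquiv
      map_mul' := fun x y => (endMulEquivSubgroup K).map_mul x y }

end FreeKernel

/-! ### The Bass–Serre tree -/

section Tree

variable {S : Type*} [Group S] {r : ℕ} {G : Fin r → Type*} [∀ i, Group (G i)]
  {T : ∀ i, Subgroup (G i)} (f : ∀ i, T i →* S)

/-- The vertices of the Bass–Serre tree of the amalgam: the left cosets of `S` and of the `Gᵢ`. -/
abbrev Vertex : Type _ :=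
  (StarAmalgam f ⧸ (base f).range) ⊕ Σ i, StarAmalgam f ⧸ (of f i).range

/-- The coset `g S`, as a vertex of the tree. -/
def center (g : StarAmalgam f) : Vertex f := Sum.inl g

/-- The coset `g Gᵢ`, as a vertex of the tree. -/
def leaf (i : Fin r) (g : StarAmalgam f) : Vertex f := Sum.inr ⟨i, g⟩

/-- The Bass–Serre tree of the amalgam. Its edges join `g S` to `g Gᵢ`; the edge is to be thought of
as the coset `g Tᵢ`. -/
def tree : SimpleGraph (Vertex f) where
  Adj u v := ∃ i g, (u = center f g ∧ v = leaf f i g) ∨ (v = center f g ∧ u = leaf f i g)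
  symm := ⟨fun _ _ ⟨i, g, h⟩ => ⟨i, g, h.symm⟩⟩
  loopless := ⟨by
    rintro v ⟨i, g, ⟨h₁, h₂⟩ | ⟨h₁, h₂⟩⟩ <;> simp [h₁, center, leaf] at h₂⟩

variable {f}

theorem center_eq_center {g g' : StarAmalgam f} :
    center f g = center f g' ↔ ∃ s, g' = g * base f s := by
  simp only [center, Sum.inl.injEq, QuotientGroup.eq, MonoidHom.mem_range, eq_inv_mul_iff_mul_eq]
  exact exists_congr fun _ => eq_comm

theorem leaf_eq_leaf {i : Fin r} {g g' : StarAmalgam f} :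
    leaf f i g = leaf f i g' ↔ ∃ k, g' = g * of f i k := by
  simp only [leaf, Sum.inr.injEq, Sigma.mk.injEq, true_and, heq_eq_eq, QuotientGroup.eq,
    MonoidHom.mem_range, eq_inv_mul_iff_mul_eq]
  exact exists_congr fun _ => eq_comm

theorem index_eq_of_leaf_eq_leaf {i j : Fin r} {g g' : StarAmalgam f}
    (h : leaf f i g = leaf f j g') : i = j := by
  simp only [leaf, Sum.inr.injEq, Sigma.mk.injEq] at h
  exact h.1

theorem exists_eq_center_or_leaf (v : Vertex f) :
    (∃ g, v = center f g) ∨ ∃ i g, v = leaf f i g := by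
  rcases v with x | ⟨i, x⟩
  · obtain ⟨g, rfl⟩ := QuotientGroup.mk_surjective x
    exact Or.inl ⟨g, rfl⟩
  · obtain ⟨g, rfl⟩ := QuotientGroup.mk_surjective x
    exact Or.inr ⟨i, g, rfl⟩

@[simp]
theorem smul_center (g h : StarAmalgam f) : g • center f h = center f (g * h) := rfl

@[simp]
theorem smul_leaf (i : Fin r) (g h : StarAmalgam f) : g • leaf f i h = leaf f i (g * h) := rfl

theorem smul_center_eq_self {g h : StarAmalgam f} :
    g • center f h = center f h ↔ ∃ s, g * h = h * base f s := by
  rw [smul_center, eq_comm, center_eq_center]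

theorem smul_leaf_eq_self {i : Fin r} {g h : StarAmalgam f} :
    g • leaf f i h = leaf f i h ↔ ∃ k, g * h = h * of f i k := by
  rw [smul_leaf, eq_comm, leaf_eq_leaf]

theorem adj_center_leaf (i : Fin r) (g : StarAmalgam f) :
    (tree f).Adj (center f g) (leaf f i g) := ⟨i, g, Or.inl ⟨rfl, rfl⟩⟩

theorem exists_of_adj_center {g : StarAmalgam f} {v : Vertex f}
    (h : (tree f).Adj (center f g) v) : ∃ i s, v = leaf f i (g * base f s) := by
  obtain ⟨i, g', ⟨h₁, rfl⟩ | ⟨-, h₂⟩⟩ := h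
  · obtain ⟨s, rfl⟩ := center_eq_center.1 h₁
    exact ⟨i, s, rfl⟩
  · simp [center, leaf] at h₂

theorem exists_of_adj_leaf {i : Fin r} {g : StarAmalgam f} {v : Vertex f}
    (h : (tree f).Adj (leaf f i g) v) : ∃ k, v = center f (g * of f i k) := by
  obtain ⟨j, g', ⟨h₁, -⟩ | ⟨rfl, h₂⟩⟩ := h
  · simp [center, leaf] at h₁
  · obtain rfl := index_eq_of_leaf_eq_leaf h₂
    obtain ⟨k, rfl⟩ := leaf_eq_leaf.1 h₂
    exact ⟨k, rfl⟩

theorem smul_adj (g : StarAmalgam f) {u v : Vertex f} (h : (tree f).Adj u v) :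
    (tree f).Adj (g • u) (g • v) := by
  obtain ⟨i, g', ⟨rfl, rfl⟩ | ⟨rfl, rfl⟩⟩ := h
  · exact adj_center_leaf i (g * g')
  · exact (adj_center_leaf i (g * g')).symm

/-- The action preserves the two kinds of vertices, so it does not invert edges. -/
theorem not_adj_smul (g : StarAmalgam f) (v : Vertex f) : ¬ (tree f).Adj v (g • v) := by
  intro h
  rcases exists_eq_center_or_leaf v with ⟨g', rfl⟩ | ⟨i, g', rfl⟩
  · obtain ⟨i, s, h⟩ := exists_of_adj_center h
    simp [center, leaf] at h
  · obtain ⟨k, h⟩ := exists_of_adj_leaf h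
    simp [center, leaf] at h

theorem tree_connected : (tree f).Connected := by
  have h : ∀ g, (tree f).Reachable (center f 1) (center f g) := by
    intro g
    induction g using induction_on with
    | hbase s =>
      rw [center_eq_center.2 ⟨s, (one_mul _).symm⟩]
    | hof i k =>
      refine (adj_center_leaf i 1).reachable.trans ?_
      rw [leaf_eq_leaf.2 ⟨k, (one_mul _).symm⟩]
      exact (adj_center_leaf i _).symm.reachable
    | hmul x y hx hy =>
      refine hx.trans ?_
      have := hy.map (⟨fun v => x • v, fun {a b} => smul_adj x⟩ : tree f →g tree f)
      simpa using this
  have h' : ∀ v, (tree f).Reachable (center f 1) v := by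
    intro v
    rcases exists_eq_center_or_leaf v with ⟨g, rfl⟩ | ⟨i, g, rfl⟩
    · exact h g
    · exact (h g).trans (adj_center_leaf i g).reachable
  exact { preconnected := fun u v => (h' u).symm.trans (h' v), nonempty := ⟨center f 1⟩ }

/-- A label `χ` of the vertices which tells apart the ends of the edge joining `S` to `Gᵢ`, but not
the ends of the edge joining `g S` to `g Gⱼ` unless `j = i` and `g ∈ Tᵢ`. The label of `g S` is
the value of a crossed homomorphism at the base point of the coset space of `Tᵢ`. -/
theorem exists_potential (i : Fin r) :
    ∃ χ : Vertex f → Multiplicative ℤ, χ (center f 1) ≠ χ (leaf f i 1) ∧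
      ∀ j g, χ (center f g) ≠ χ (leaf f j g) → j = i ∧ ∃ t : T i, g = of f i t := by
  classical
  let U : Subgroup (StarAmalgam f) := (T i).map (of f i)
  let x₀ : StarAmalgam f ⧸ U := QuotientGroup.mk 1
  let h : Fin r → StarAmalgam f ⧸ U → Multiplicative ℤ := fun j x =>
    if j = i ∧ x = x₀ then Multiplicative.ofAdd 1 else 1
  obtain ⟨c, hc, hcS, hcG⟩ := exists_crossed f h (by
    intro j t x
    by_cases hj : j = i
    · subst hj
      have ht : of f j t ∈ U := ⟨t, t.2, rfl⟩
      have : (of f j t)⁻¹ • x₀ = x₀ := by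
        refine QuotientGroup.eq.2 ?_
        simpa using ht
      simp only [h, ← eq_inv_smul_iff, this]
    · simp [h, hj])
  let χ : Vertex f → Multiplicative ℤ := Sum.elim
    (Quotient.lift (fun g => c g x₀) (by
      intro g g' hg
      obtain ⟨s, hs⟩ := QuotientGroup.leftRel_apply.1 hg
      obtain rfl : g' = g * base f s := by rw [hs, mul_inv_cancel_left]
      simp [hc, hcS]))
    (fun v => Quotient.lift (fun g => c g x₀ * h v.1 (g⁻¹ • x₀)) (by
      intro g g' hg
      obtain ⟨k, hk⟩ := QuotientGroup.leftRel_apply.1 hg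
      obtain rfl : g' = g * of f v.1 k := by rw [hk, mul_inv_cancel_left]
      simp [hc, hcG, mul_smul, mul_assoc]) v.2)
  have hχ₁ : ∀ g, χ (center f g) = c g x₀ := fun g => rfl
  have hχ₂ : ∀ j g, χ (leaf f j g) = c g x₀ * h j (g⁻¹ • x₀) := fun j g => rfl
  refine ⟨χ, ?_, fun j g hne => ?_⟩
  · rw [hχ₁, hχ₂, inv_one, one_smul]
    simp [h]
  · rw [hχ₁, hχ₂] at hne
    have h₁ : j = i ∧ g⁻¹ • x₀ = x₀ := by
      by_contra hcon
      simp [h, hcon] at hne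
    refine ⟨h₁.1, ?_⟩
    obtain ⟨t, ht, ht'⟩ := QuotientGroup.eq.1 (inv_smul_eq_iff.1 h₁.2)
    exact ⟨⟨t, ht⟩, by simpa using ht'.symm⟩

/-- The Bass–Serre tree is a tree: the labels of `exists_potential` show that the ends of an edge
cannot be joined without using it. -/
theorem tree_isTree : (tree f).IsTree := by
  refine ⟨tree_connected, ?_⟩
  rw [SimpleGraph.isAcyclic_iff_forall_adj_isBridge]
  have key : ∀ i g, (tree f).IsBridge s(center f g, leaf f i g) := by
    intro i g
    obtain ⟨χ, hχ, hχ'⟩ := exists_potential (f := f) i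
    rw [SimpleGraph.isBridge_iff]
    rintro ⟨p⟩
    have hconst : ∀ {u v : Vertex f},
        ((tree f).deleteEdges {s(center f g, leaf f i g)}).Walk u v →
          χ (g⁻¹ • u) = χ (g⁻¹ • v) := by
      intro u v p
      induction p with
      | nil => rfl
      | @cons u v w hadj p ih =>
        refine Eq.trans ?_ ih
        rw [SimpleGraph.deleteEdges_adj] at hadj
        obtain ⟨⟨j, g', hj⟩, hne⟩ := hadj
        have : χ (g⁻¹ • center f g') = χ (g⁻¹ • leaf f j g') := by
          by_contra hcon
          obtain ⟨rfl, t, ht⟩ := hχ' j (g⁻¹ * g') hcon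
          rw [inv_mul_eq_iff_eq_mul] at ht
          have h₁ : center f g = center f g' :=
            center_eq_center.2 ⟨f j t, by rw [ht, of_eq_base]⟩
          have h₂ : leaf f j g = leaf f j g' := leaf_eq_leaf.2 ⟨t, ht⟩
          apply hne
          rw [h₁, h₂]
          rcases hj with ⟨rfl, rfl⟩ | ⟨rfl, rfl⟩
          · rfl
          · exact Sym2.eq_swap
        rcases hj with ⟨rfl, rfl⟩ | ⟨rfl, rfl⟩
        · exact this
        · exact this.symm
    apply hχ
    simpa using hconst p
  rintro u v ⟨i, g, ⟨rfl, rfl⟩ | ⟨rfl, rfl⟩⟩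
  · exact key i g
  · rw [Sym2.eq_swap]
    exact key i g

/-- In the amalgam, `S` and `Gᵢ` meet in `Tᵢ`. -/
theorem mem_of_base_eq_of {i : Fin r} {s : S} {k : G i} (hinj : Function.Injective (of f i))
    (h : base f s = of f i k) : k ∈ T i := by
  obtain ⟨χ, hχ, hχ'⟩ := exists_potential (f := f) i
  have h₁ : center f (of f i k) = center f 1 :=
    (center_eq_center.2 ⟨s, by rw [one_mul, h]⟩).symm
  have h₂ : leaf f i (of f i k) = leaf f i 1 :=
    (leaf_eq_leaf.2 ⟨k, by rw [one_mul]⟩).symm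
  obtain ⟨-, t, ht⟩ := hχ' i (of f i k) (by rwa [h₁, h₂])
  rw [hinj ht]
  exact t.2

end Tree

/-! ### Fusion in the amalgam -/

section Fusion

/-- If conjugation by `c` carries a subgroup `P` of `S` into `S`, then it is an isomorphism from `P`
to a subgroup of `S`. -/
theorem exists_conj_equiv {S Γ : Type*} [Group S] [Group Γ] {j : S →* Γ}
    (hj : Function.Injective j) (c : Γ) (P : Subgroup S)
    (h : ∀ u : P, ∃ v, j v = c⁻¹ * j u * c) :
    ∃ (R : Subgroup S) (ψ : P ≃* R), ∀ u, j (ψ u) = c⁻¹ * j u * c := by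
  choose v hv using h
  let ψ : P →* S :=
    { toFun := v
      map_one' := hj (by simp [hv])
      map_mul' := fun a b => hj (by rw [map_mul, hv, hv, hv, Subgroup.coe_mul, map_mul]; group) }
  have hψ : Function.Injective ψ := fun a b hab => by
    have : c⁻¹ * j a * c = c⁻¹ * j b * c := by rw [← hv, ← hv]; exact congrArg j hab
    exact Subtype.ext (hj (by simpa using this))
  exact ⟨ψ.range, MonoidHom.ofInjective hψ, hv⟩

variable {S : Type*} [Group S] {r : ℕ} {G : Fin r → Type*} [∀ i, Group (G i)]
  {T : ∀ i, Subgroup (G i)} {f : ∀ i, T i →* S}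

/-- A homomorphism induced by an element of `Gᵢ` between subgroups of `fᵢ(Tᵢ)` lies in the image of
the fusion system of `Gᵢ`. -/
theorem mem_image_of_conj (hbase : Function.Injective (base f))
    (hof : ∀ i, Function.Injective (of f i)) {i : Fin r} (k : G i) {P Q : Subgroup S} (ψ : P →* Q)
    (hψ : ∀ u, base f (ψ u) = (of f i k)⁻¹ * base f u * of f i k)
    (hP : P ≤ (f i).range) (hQ : Q ≤ (f i).range) :
    ψ ∈ FusionSystem.image (f i)
      (FusionSystem.ofEmbedding (T i).subtype (T i).subtype_injective) P Q := by
  have hψ' : ∀ t : P.comap (f i), base f (ψ ⟨f i t, t.2⟩) = of f i (k⁻¹ * (t : T i) * k) :=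
    fun t => by
      rw [hψ, ← of_eq_base]
      simp
  have hT : ∀ t : P.comap (f i), k⁻¹ * (t : T i) * k ∈ T i := fun t =>
    mem_of_base_eq_of (hof i) (hψ' t)
  have hf : ∀ t : P.comap (f i), (ψ ⟨f i t, t.2⟩ : S) = f i ⟨_, hT t⟩ := fun t =>
    hbase (by rw [hψ', ← of_eq_base])
  let φ : P.comap (f i) →* Q.comap (f i) :=
    { toFun := fun t => ⟨⟨_, hT t⟩, by
        rw [Subgroup.mem_comap, ← hf]
        exact (ψ _).2⟩
      map_one' := by ext; simp
      map_mul' := fun t t' => by ext; simp [mul_assoc] }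
  refine ⟨P.comap (f i), Q.comap (f i), φ, ⟨k, fun u => rfl⟩, Subgroup.map_comap_eq_self hP,
    Subgroup.map_comap_eq_self hQ, fun x y hxy => ?_⟩
  obtain rfl : y = ⟨f i x, x.2⟩ := Subtype.ext hxy
  exact hf x

/-- A fusion system on `S` that contains the images of those of the `Gᵢ` contains all homomorphisms
between subgroups of `S` induced by conjugation in the amalgam. If `g` conjugates `P` into `S`, then
`P` fixes the vertices `S` and `g S` of the tree, hence the path between them; its first two edges
lead from `S` to `s Gᵢ` and to `s k S` with `s ∈ S` and `k ∈ Gᵢ`, so that conjugation by `s k` is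
the composite of a conjugation in `S` and one in `Gᵢ`, and brings the problem closer to the end. -/
theorem mem_hom_of_conj (hbase : Function.Injective (base f))
    (hof : ∀ i, Function.Injective (of f i)) {F : FusionSystem S}
    (hF : ∀ i P Q, FusionSystem.image (f i)
      (FusionSystem.ofEmbedding (T i).subtype (T i).subtype_injective) P Q ⊆ F.Hom P Q)
    (g : StarAmalgam f) {P Q : Subgroup S} (φ : P →* Q)
    (hφ : ∀ u, base f (φ u) = g⁻¹ * base f u * g) : φ ∈ F.Hom P Q := by
  induction hn : (tree f).dist (center f g) (center f 1) using Nat.strong_induction_on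
    generalizing g P Q with
  | _ n ih =>
    by_cases hg : center f 1 = center f g
    · obtain ⟨s, rfl⟩ := center_eq_center.1 hg
      exact F.conj_mem s φ fun u => hbase (by simpa using hφ u)
    have hadj : ∀ (h : StarAmalgam f) (u v : Vertex f),
      (tree f).Adj u v → (tree f).Adj (h • u) (h • v) := fun h _ _ => smul_adj h
    -- the first two edges of the path
    obtain ⟨m, hm, hm'⟩ := tree_connected.exists_adj_dist_eq_add_one hg
    obtain ⟨i, s, rfl⟩ := exists_of_adj_center hm.symm
    rw [one_mul] at hm hm'
    have hg' : leaf f i (base f s) ≠ center f g := by simp [leaf, center]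
    obtain ⟨m, hl, hl'⟩ := tree_connected.exists_adj_dist_eq_add_one hg'
    obtain ⟨k, rfl⟩ := exists_of_adj_leaf hl.symm
    have hfix : ∀ u : P, base f u • center f g = center f g := fun u =>
      smul_center_eq_self.2 ⟨φ u, by rw [hφ]; group⟩
    have hfix₀ : ∀ u : P, base f u • center f 1 = center f 1 := fun u =>
      smul_center_eq_self.2 ⟨u, by simp⟩
    have hfix₁ : ∀ u : P, base f u • leaf f i (base f s) = leaf f i (base f s) := fun u =>
      tree_isTree.smul_eq_of_adj_of_dist hadj (hfix u) (hfix₀ u) hm hm'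
    have hfix₂ : ∀ u : P, base f u • center f (base f s * of f i k) =
        center f (base f s * of f i k) := fun u =>
      tree_isTree.smul_eq_of_adj_of_dist hadj (hfix u) (hfix₁ u) hl hl'
    -- conjugation by `s` and by `s k`
    obtain ⟨P₁, ψ₁, hψ₁⟩ := exists_conj_equiv hbase (base f s) P fun u => ⟨s⁻¹ * u * s, by simp⟩
    obtain ⟨P₂, ψ, hψ⟩ := exists_conj_equiv hbase (base f s * of f i k) P fun u => by
      obtain ⟨v, hv⟩ := smul_center_eq_self.1 (hfix₂ u)
      exact ⟨v, by rw [mul_assoc, hv, inv_mul_cancel_left]⟩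
    have hψ₂ : ∀ y, base f (ψ (ψ₁.symm y)) = (of f i k)⁻¹ * base f y * of f i k := fun y => by
      obtain ⟨u, rfl⟩ := ψ₁.surjective y
      rw [ψ₁.symm_apply_apply, hψ, hψ₁]
      group
    have hP₁ : ∀ y : P₁, ∃ t : T i, base f y = of f i t := fun y => by
      obtain ⟨u, rfl⟩ := ψ₁.surjective y
      obtain ⟨k', hk'⟩ := smul_leaf_eq_self.1 (hfix₁ u)
      have h : base f (ψ₁ u) = of f i k' := by
        rw [hψ₁, mul_assoc, hk', inv_mul_cancel_left]
      exact ⟨⟨k', mem_of_base_eq_of (hof i) h⟩, h⟩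
    have hP₁' : P₁ ≤ (f i).range := fun y hy => by
      obtain ⟨t, ht⟩ := hP₁ ⟨y, hy⟩
      exact ⟨t, hbase (by rw [← of_eq_base, ← ht])⟩
    have hP₂' : P₂ ≤ (f i).range := fun z hz => by
      obtain ⟨y, hy⟩ := (ψ₁.symm.trans ψ).surjective ⟨z, hz⟩
      obtain ⟨t, ht⟩ := hP₁ y
      have h : base f z = of f i (k⁻¹ * t * k) := by
        have h' := hψ₂ y
        rw [← MulEquiv.trans_apply, hy, ht] at h'
        simpa using h'
      exact ⟨⟨_, mem_of_base_eq_of (hof i) h⟩, hbase (by rw [← of_eq_base, ← h])⟩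
    have h₁ : ψ₁.toMonoidHom ∈ F.Hom P P₁ :=
      F.conj_mem s _ fun u => hbase (by simpa using hψ₁ u)
    have h₂ : (ψ₁.symm.trans ψ).toMonoidHom ∈ F.Hom P₁ P₂ :=
      hF i _ _ (mem_image_of_conj hbase hof k _ hψ₂ hP₁' hP₂')
    have h₃ : φ.comp ψ.symm.toMonoidHom ∈ F.Hom P₂ Q := by
      refine ih _ ?_ ((base f s * of f i k)⁻¹ * g) _ (fun z => ?_) rfl
      · have h := SimpleGraph.dist_smul hadj (base f s * of f i k)
          (center f ((base f s * of f i k)⁻¹ * g)) (center f 1)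
        rw [smul_center, smul_center, mul_inv_cancel_left, mul_one] at h
        omega
      · obtain ⟨u, rfl⟩ := ψ.surjective z
        simp only [MonoidHom.comp_apply, MulEquiv.coe_toMonoidHom, MulEquiv.symm_apply_apply, hφ,
          hψ]
        group
    convert F.comp_mem h₁ (F.comp_mem h₂ h₃) using 1
    ext u
    simp

end Fusion

/-! ### Finite subgroups and `p`-subgroups -/

section FiniteSubgroups

/-- A free group contains no nontrivial elements of finite order. -/
theorem eq_one_of_pow_eq_one {Γ : Type*} [Group Γ] [IsFreeGroup Γ] {x : Γ} {n : ℕ} (hn : n ≠ 0)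
    (h : x ^ n = 1) : x = 1 := by
  apply (IsFreeGroup.toFreeGroup Γ).injective
  rw [map_one]
  refine (pow_eq_one_iff_left hn).1 ?_
  rw [← map_pow, h, map_one]

/-- A free normal subgroup of finite index meets a `p`-subgroup trivially, so that the latter embeds
into the finite quotient. -/
theorem finite_of_isPGroup {p : ℕ} [Fact p.Prime] {Γ : Type*} [Group Γ] (K : Subgroup Γ) [K.Normal]
    [IsFreeGroup K] [K.FiniteIndex] (P : Subgroup Γ) (hP : IsPGroup p P) : Finite P := by
  have hinj : Function.Injective ((QuotientGroup.mk' K).comp P.subtype) := by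
    rw [injective_iff_map_eq_one]
    intro x hx
    have hxK : (x : Γ) ∈ K := (QuotientGroup.eq_one_iff _).1 hx
    obtain ⟨n, hn⟩ := hP x
    have h : (⟨x, hxK⟩ : K) ^ p ^ n = 1 :=
      Subtype.ext (by simpa using congrArg Subtype.val hn)
    have h' := eq_one_of_pow_eq_one (pow_ne_zero n (Fact.out : p.Prime).ne_zero) h
    exact Subtype.ext (congrArg Subtype.val h' :)
  exact Finite.of_injective _ hinj

variable {S : Type*} [Group S] {r : ℕ} {G : Fin r → Type*} [∀ i, Group (G i)]
  {T : ∀ i, Subgroup (G i)} {f : ∀ i, T i →* S}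

/-- A finite subgroup fixes a vertex of the tree, so it is conjugate into `S` or one of the `Gᵢ`. -/
theorem exists_conj_le_of_finite (H : Subgroup (StarAmalgam f)) [Finite H] :
    ∃ g : StarAmalgam f, H.map (MulAut.conj g).toMonoidHom ≤ (base f).range ∨
      ∃ i, H.map (MulAut.conj g).toMonoidHom ≤ (of f i).range := by
  obtain ⟨v, hv⟩ := tree_isTree.exists_fixed_vertex (H := H) (V := Vertex f)
    (fun h _ _ => smul_adj (h : StarAmalgam f)) (fun h v => not_adj_smul (h : StarAmalgam f) v)
  rcases exists_eq_center_or_leaf v with ⟨g, rfl⟩ | ⟨i, g, rfl⟩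
  · refine ⟨g⁻¹, Or.inl ?_⟩
    rintro _ ⟨h, hh, rfl⟩
    obtain ⟨s, hs⟩ := smul_center_eq_self.1 (hv ⟨h, hh⟩)
    exact ⟨s, by simp [mul_assoc, hs]⟩
  · refine ⟨g⁻¹, Or.inr ⟨i, ?_⟩⟩
    rintro _ ⟨h, hh, rfl⟩
    obtain ⟨k, hk⟩ := smul_leaf_eq_self.1 (hv ⟨h, hh⟩)
    exact ⟨k, by simp [mul_assoc, hk]⟩

/-- By Sylow's theorem in the `Gᵢ`, a finite `p`-subgroup is conjugate into `S`. -/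
theorem exists_conj_le_base {p : ℕ} [Fact p.Prime] [∀ i, Finite (G i)] {T : ∀ i, Sylow p (G i)}
    {f : ∀ i, (T i).toSubgroup →* S} (hof : ∀ i, Function.Injective (of f i))
    (P : Subgroup (StarAmalgam f)) [Finite P] (hP : IsPGroup p P) :
    ∃ g : StarAmalgam f, P.map (MulAut.conj g).toMonoidHom ≤ (base f).range := by
  obtain ⟨g, hg | ⟨i, hg⟩⟩ := exists_conj_le_of_finite P
  · exact ⟨g, hg⟩
  obtain ⟨Q, hQ⟩ := ((hP.map (MulAut.conj g).toMonoidHom).comap_of_injective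
    (of f i) (hof i)).exists_le_sylow
  obtain ⟨k, hk⟩ := MulAction.exists_smul_eq (G i) Q (T i)
  refine ⟨of f i k * g, ?_⟩
  rintro _ ⟨x, hx, rfl⟩
  obtain ⟨y, hy⟩ := hg ⟨x, hx, rfl⟩
  have hyQ : y ∈ (Q : Subgroup (G i)) := hQ ⟨x, hx, hy.symm⟩
  have hyT : k * y * k⁻¹ ∈ T i := by
    rw [← hk]
    exact ⟨y, hyQ, rfl⟩
  refine ⟨f i ⟨_, hyT⟩, ?_⟩
  rw [← of_eq_base]
  simp only [MulEquiv.coe_toMonoidHom, MulAut.conj_apply] at hy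
  simp [hy, mul_assoc]

end FiniteSubgroups

end StarAmalgam

/-! ### The main result -/

theorem theorem2 {p : ℕ} [Fact p.Prime] {S : Type*} [Group S] [Finite S] (hS : IsPGroup p S)
    {r : ℕ} {G : Fin r → Type*} [∀ i, Group (G i)] [∀ i, Finite (G i)]
    (T : ∀ i, Sylow p (G i)) (f : ∀ i, (T i).toSubgroup →* S)
    (hf : ∀ i, Function.Injective (f i))
    (F : FusionSystem S)
    (hF : F = FusionSystem.generate fun P Q => ⋃ i, FusionSystem.image (f i)
      (FusionSystem.ofEmbedding (T i).toSubgroup.subtype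
        (T i).toSubgroup.subtype_injective) P Q) :
    (∃ hinj : Function.Injective (StarAmalgam.base f),
      FusionSystem.ofEmbedding (StarAmalgam.base f) hinj = F) ∧
    (∀ i, Function.Injective (StarAmalgam.of f i)) ∧
    (∀ P : Subgroup (StarAmalgam f), IsPGroup p P →
      ∃ g : StarAmalgam f,
        P.map (MulAut.conj g).toMonoidHom ≤ (StarAmalgam.base f).range) ∧
    (∀ H : Subgroup (StarAmalgam f), Finite H →
      ∃ g : StarAmalgam f,
        H.map (MulAut.conj g).toMonoidHom ≤ (StarAmalgam.base f).range ∨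
        ∃ i, H.map (MulAut.conj g).toMonoidHom ≤ (StarAmalgam.of f i).range) ∧
    (∃ K : Subgroup (StarAmalgam f), K.Normal ∧ IsFreeGroup K ∧
      K.index ∣
        Nat.factorial (Nat.lcm (Nat.card S) (Finset.univ.lcm fun i => Nat.card (G i)))) := by
  set N := Nat.lcm (Nat.card S) (Finset.univ.lcm fun i => Nat.card (G i)) with hN
  have hSN : Nat.card S ∣ N := Nat.dvd_lcm_left _ _
  have hGN : ∀ i, Nat.card (G i) ∣ N := fun i =>
    (Finset.dvd_lcm (f := fun i => Nat.card (G i)) (Finset.mem_univ i)).trans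
      (Nat.dvd_lcm_right _ _)
  have hN0 : N ≠ 0 := by
    refine Nat.lcm_ne_zero Nat.card_pos.ne' fun h => ?_
    obtain ⟨i, -, hi⟩ := Finset.lcm_eq_zero_iff.1 h
    exact Nat.card_pos.ne' hi
  obtain ⟨ρ, hρS, hρG⟩ := StarAmalgam.exists_permutation_representation f hf hSN hGN
  have hX : Nat.card (S × Fin (N / Nat.card S)) = N := by
    rw [Nat.card_prod, Nat.card_fin, Nat.mul_div_cancel' hSN]
  have x₀ : S × Fin (N / Nat.card S) :=
    ((Nat.card_pos_iff.1 (hX.symm ▸ Nat.pos_of_ne_zero hN0 : 0 < Nat.card _)).1).some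
  have hSK : ∀ s, StarAmalgam.base f s ∈ ρ.ker → s = 1 := fun s hs =>
    hρS s x₀ (by rw [MonoidHom.mem_ker.1 hs, Equiv.Perm.one_apply])
  have hGK : ∀ i k, StarAmalgam.of f i k ∈ ρ.ker → k = 1 := fun i k hk =>
    hρG i k x₀ (by rw [MonoidHom.mem_ker.1 hk, Equiv.Perm.one_apply])
  have hbase : Function.Injective (StarAmalgam.base f) :=
    (injective_iff_map_eq_one _).2 fun s hs => hSK s (hs ▸ one_mem _)
  have hof : ∀ i, Function.Injective (StarAmalgam.of f i) := fun i =>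
    (injective_iff_map_eq_one _).2 fun k hk => hGK i k (hk ▸ one_mem _)
  have hfree : IsFreeGroup ρ.ker := StarAmalgam.isFreeGroup_of_normal f ρ.ker hSK hGK
  have hindex : ρ.ker.index ∣ N.factorial := by
    rw [Subgroup.index_ker]
    refine (Subgroup.card_subgroup_dvd_card _).trans ?_
    rw [Nat.card_perm, hX]
  have hfin : ρ.ker.FiniteIndex := ⟨fun h => by
    rw [h, zero_dvd_iff] at hindex
    exact N.factorial_ne_zero hindex⟩
  refine ⟨⟨hbase, ?_⟩, hof, fun P hP => ?_, fun H _ => StarAmalgam.exists_conj_le_of_finite H,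
    ρ.ker, inferInstance, hfree, hindex⟩
  · subst hF
    have hle : ∀ P Q i, FusionSystem.image (f i)
        (FusionSystem.ofEmbedding (T i).toSubgroup.subtype
          (T i).toSubgroup.subtype_injective) P Q ⊆
        (FusionSystem.ofEmbedding (StarAmalgam.base f) hbase).Hom P Q := by
      rintro P Q i φ ⟨P', Q', φ', ⟨k, hk⟩, rfl, rfl, hφ'⟩
      refine ⟨StarAmalgam.of f i k, fun u => ?_⟩
      obtain ⟨_, x, hx, rfl⟩ := u
      rw [hφ' ⟨x, hx⟩ _ rfl, ← StarAmalgam.of_eq_base]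
      change _ = _ * StarAmalgam.base f (f i x) * _
      rw [← StarAmalgam.of_eq_base, ← map_inv, ← map_mul, ← map_mul]
      exact congrArg _ (hk ⟨x, hx⟩)
    ext P Q φ
    constructor
    · rintro ⟨g, hg⟩
      refine StarAmalgam.mem_hom_of_conj hbase hof (fun i P Q φ hφ => ?_) g φ hg
      exact ⟨FusionSystem.injective _ (hle P Q i hφ),
        fun F hF => hF P Q (Set.mem_iUnion.2 ⟨i, hφ⟩)⟩
    · rintro ⟨-, h⟩
      exact h _ fun P Q => Set.iUnion_subset (hle P Q)
  · have := StarAmalgam.finite_of_isPGroup ρ.ker P hP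
    exact StarAmalgam.exists_conj_le_base hof P hP
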